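/- Let $R$ be an integral domain of characteristic $0$ with field of fractions $K$, let $m\ge 2$ be an integer, and let \[ \varphi(x)=x^m\sum_{k=0}^\infty b_kx^k\in R[\![x]\!]\quad\text{with } b_0=1 . \] Then there is a unique power series $f_\varphi(x)\in x+x^2K[\![x]\!]$ (the Böttcher coordinate of $\varphi$) satisfying $\varphi(f_\varphi(x))=f_\varphi(x^m)$. Let $f_\varphi^{-1}(x)\in x+x^2K[\![x]\!]$ denote its inverse under composition. (a) Both $f_\varphi(x)$ and $f_\varphi^{-1}(x)$ are series of the form \[ x\sum_{k=0}^\infty\frac{a_k}{m^k\,k!}x^k\quad\text{with } a_0=1 \text{ and } a_k\in R \text{ for all } k. \] (b) Suppose in addition that $k!\,b_k\in mR$ for all $1\le k<m$. (For example, this is true if $\varphi(x)\in x^m+m x^{m+1}R[\![x]\!]$.) Then both $f_\varphi(x)$ and $f_\varphi^{-1}(x)$ are series of the form \[ x\sum_{k=0}^\infty\frac{a_k}{k!}x^k\quad\text{with } a_0=1 \text{ and } a_k\in R \text{ for all } k. \] -/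

import Mathlib

open PowerSeries

/-- `f` is a Böttcher coordinate of the power series `φ ∈ x^m + x^(m+1) K⟦x⟧` over a field `K`:
`f ∈ x + x^2 K⟦x⟧` and `φ(f(x)) = f(x^m)`.
(In Mathlib, `φ.subst f` is the composition `φ ∘ f`.) -/
structure IsBottcherCoordinate {K : Type*} [Field K] (m : ℕ) (φ f : K⟦X⟧) : Prop where
  constantCoeff_eq_zero : PowerSeries.constantCoeff f = 0
  coeff_one_eq_one : PowerSeries.coeff 1 f = 1
  functional_equation : φ.subst f = f.subst (X ^ m : K⟦X⟧)

/-- The linear coefficient is a unit, so that the compositional inverse of `f` makes sense. -/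
theorem IsBottcherCoordinate.isUnit_coeff_one {K : Type*} [Field K] {m : ℕ} {φ f : K⟦X⟧}
    (hf : IsBottcherCoordinate m φ f) : IsUnit (PowerSeries.coeff 1 f) :=
  hf.coeff_one_eq_one ▸ isUnit_one

/-- The compositional inverse `f⁻¹` of a Böttcher coordinate `f`,
i.e. the power series with `f ∘ f⁻¹ = x = f⁻¹ ∘ f`. -/
noncomputable def IsBottcherCoordinate.inverse {K : Type*} [Field K] {m : ℕ} {φ f : K⟦X⟧}
    (hf : IsBottcherCoordinate m φ f) : K⟦X⟧ :=
  f.substInvOfIsUnit hf.isUnit_coeff_one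

/-- `f ∈ K⟦x⟧` has the form `x ∑ a_k / (d^k k!) x^k` with `a_0 = 1` and all `a_k ∈ R`. -/
def HasFactorialForm (R : Type*) {K : Type*} [CommRing R] [Field K] [Algebra R K]
    (d : ℕ) (f : K⟦X⟧) : Prop :=
  ∃ a : ℕ → R, a 0 = 1 ∧
    f = X * PowerSeries.mk fun k => algebraMap R K (a k) / ((d : K) ^ k * (k.factorial : K))

/-!
Let `g` be the compositional inverse of the Böttcher coordinate of `φ = x^m B`. The functional
equation `φ(f(x)) = f(x^m)` is equivalent to `g(φ(x)) = g(x)^m`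
(`subst_eq_subst_X_pow_iff`), and with `g = x v` it becomes
`v^m = B · (v ∘ φ)`, that is, `v = (B · (v ∘ φ))^(1/m)`. As `φ` has order at least `2`, each
coefficient of the right-hand side depends only on earlier coefficients of `v`, so there is exactly
one solution `v` with constant coefficient `1`.

The integrality statement is that `v` is a Hurwitz series over `R` (a series `∑ a_k x^k / k!` with
`a_k ∈ R`). Hurwitz series form a ring `hurwitzSubring` which contains the divided powers `z^k / k!`
of each of its elements `z` without constant term, hence is closed under substitution of such `z`.
The series `(1 + m x)^(1/m)` is a Hurwitz series, so `m`-th roots of `1 + m z` exist in the ring.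
If `B - 1` and `Φ` lie in `m` times the ring, then so do `v ∘ Φ - 1` and `B · (v ∘ Φ) - 1` for every
Hurwitz series `v` with constant coefficient `1`, and the iteration for `v^m = B · (v ∘ Φ)` stays
among Hurwitz series (`exists_pow_eq_mul_subst`). The same contraction argument, applied to
`u = v⁻¹ ∘ (x u)`, shows that the compositional inverse `x u` of `x v` again has `u` a Hurwitz
series (`rescale_mem_of_subst_eq_X`).

Both parts of the theorem are instances of `IsBottcherCoordinate.hasFactorialForm`, in which
`x` is replaced by `d x`: this turns the denominators `d^k k!` into `k!`, the series `B` into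
`B(d x)`, and `φ` into `Φ(x) = φ(d x) / d`. For `d = m` both `B(m x) - 1` and `φ(m x) / m` are
visibly divisible by `m` over `R`. For `d = 1` the divisibility of `k! b_k` by `m` is the
hypothesis when `k < m`, and is automatic when `k ≥ m` since then `m ∣ k!`.
-/

/-! ### Hurwitz series -/

/-- The ring of Hurwitz series over a subring `S` of a field `K`: the power series
`∑ a_k x^k / k!` with all `a_k ∈ S`, encoded by the condition that `k!` times the coefficient of
`x^k` lies in `S`. -/
def hurwitzSubring {K : Type*} [Field K] (S : Subring K) : Subring K⟦X⟧ where
  carrier := {f | ∀ n, (n.factorial : K) * coeff n f ∈ S}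
  zero_mem' n := by simp
  one_mem' n := by
    rw [coeff_one]
    split_ifs <;> simp [natCast_mem]
  add_mem' {f g} hf hg n := by
    rw [map_add, mul_add]
    exact S.add_mem (hf n) (hg n)
  neg_mem' {f} hf n := by
    rw [map_neg, mul_neg]
    exact S.neg_mem (hf n)
  mul_mem' {f g} hf hg n := by
    rw [coeff_mul, Finset.mul_sum]
    refine S.sum_mem fun p hp ↦ ?_
    have h : (n.factorial : K) * (coeff p.1 f * coeff p.2 g) =
        ((p.1 + p.2).choose p.2 : K) *
          (((p.1.factorial : K) * coeff p.1 f) * ((p.2.factorial : K) * coeff p.2 g)) := by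
      rw [← Finset.HasAntidiagonal.mem_antidiagonal.mp hp, ← Nat.add_choose_mul_factorial_mul_factorial]
      push_cast
      ring
    rw [h]
    exact S.mul_mem (natCast_mem S _) (S.mul_mem (hf _) (hg _))

namespace hurwitzSubring

variable {K : Type*} [Field K] {S : Subring K} {f g z : K⟦X⟧}

theorem derivative_mem (hf : f ∈ hurwitzSubring S) : d⁄dX K f ∈ hurwitzSubring S := by
  intro n
  rw [coeff_derivative]
  have h := hf (n + 1)
  rw [Nat.factorial_succ] at h
  push_cast at h
  convert h using 1
  ring

theorem mem_of_derivative_mem (h0 : constantCoeff f ∈ S) (hf : d⁄dX K f ∈ hurwitzSubring S) :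
    f ∈ hurwitzSubring S := by
  rintro (_ | n)
  · simpa using h0
  · have h := hf n
    rw [coeff_derivative] at h
    rw [Nat.factorial_succ]
    push_cast
    convert h using 1
    ring

theorem natCast_mul_mem (n : ℕ) (hf : f ∈ hurwitzSubring S) :
    C (n : K) * f ∈ hurwitzSubring S := by
  rw [map_natCast]
  exact mul_mem (natCast_mem _ n) hf

variable [CharZero K]

/-- Hurwitz series without constant term have divided powers: the derivative of `z^(k+1) / (k+1)!`
is `(z^k / k!) z'`. -/
theorem divided_pow_mem (hz : z ∈ hurwitzSubring S) (hz0 : constantCoeff z = 0) (k : ℕ) :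
    ((k.factorial : K)⁻¹) • z ^ k ∈ hurwitzSubring S := by
  induction k with
  | zero => simp [one_mem]
  | succ k ih =>
    refine mem_of_derivative_mem (by simp [hz0]) ?_
    have h : d⁄dX K (((k + 1).factorial : K)⁻¹ • z ^ (k + 1)) =
        ((k.factorial : K)⁻¹ • z ^ k) * d⁄dX K z := by
      have hk : ((k : K) + 1) ≠ 0 := by exact_mod_cast k.succ_ne_zero
      have hk' : (k.factorial : K) ≠ 0 := by exact_mod_cast k.factorial_ne_zero
      rw [Derivation.map_smul, derivative_pow, Nat.factorial_succ]
      simp only [smul_eq_C_mul, add_tsub_cancel_right]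
      have : ((k + 1 : ℕ) : K⟦X⟧) = C ((k : K) + 1) := by simp
      rw [this, ← mul_assoc, ← mul_assoc, ← map_mul]
      congr 3
      push_cast
      field_simp
    rw [h]
    exact mul_mem ih (derivative_mem hz)

theorem subst_mem (hf : f ∈ hurwitzSubring S) (hz : z ∈ hurwitzSubring S)
    (hz0 : constantCoeff z = 0) : f.subst z ∈ hurwitzSubring S := by
  intro n
  rw [coeff_subst' (.of_constantCoeff_zero' hz0), ← smul_eq_mul, smul_finsum]
  refine finsum_induction (· ∈ S) S.zero_mem (fun _ _ ↦ S.add_mem) fun k ↦ ?_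
  have hk : (k.factorial : K) ≠ 0 := by exact_mod_cast k.factorial_ne_zero
  have h := S.mul_mem (hf k) (divided_pow_mem hz hz0 k n)
  rw [coeff_smul, smul_eq_mul] at h
  convert h using 1
  simp only [smul_eq_mul]
  field_simp

/-- The inverse is the geometric series in `1 - f`. -/
theorem inv_mem (hf : f ∈ hurwitzSubring S) (hf0 : constantCoeff f = 1) :
    f⁻¹ ∈ hurwitzSubring S := by
  have h0 : constantCoeff (1 - f) = 0 := by simp [hf0]
  have hs : HasSubst (1 - f) := .of_constantCoeff_zero' h0
  have hgeom : (mk 1 : K⟦X⟧) ∈ hurwitzSubring S := fun n ↦ by simp [natCast_mem]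
  have h1 := subst_mem hgeom (sub_mem (one_mem _) hf) h0
  have h2 : (mk 1 : K⟦X⟧).subst (1 - f) * f = 1 := by
    have := congrArg (subst (1 - f)) (mk_one_mul_one_sub_eq_one K)
    rw [← coe_substAlgHom hs] at this ⊢
    simpa [substAlgHom_X hs] using this
  have h3 : (mk 1 : K⟦X⟧).subst (1 - f) = f⁻¹ := by
    rw [PowerSeries.eq_inv_iff_mul_eq_one (by simp [hf0])]
    exact h2
  rw [← h3]
  exact h1

end hurwitzSubring

/-! ### The series `(1 + m x)^(1/m)` -/

section root

variable {K : Type*} [Field K]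

/-- The binomial series `(1 + m x)^(1/m)`, whose coefficients are
`m^k * binom(1/m, k) = 1 (1 - m) ⋯ (1 - (k - 1) m) / k!`. -/
noncomputable def rootSeries (K : Type*) [Field K] (m : ℕ) : K⟦X⟧ :=
  mk fun k ↦ (∏ i ∈ Finset.range k, (1 - (i : K) * m)) / k.factorial

theorem constantCoeff_rootSeries (m : ℕ) : constantCoeff (rootSeries K m) = 1 := by
  simp [rootSeries, ← coeff_zero_eq_constantCoeff_apply]

theorem coeff_one_add_mul_derivative (c : K) (f : K⟦X⟧) (n : ℕ) :
    coeff n ((1 + C c * X) * d⁄dX K f) = coeff (n + 1) f * (n + 1) + c * n * coeff n f := by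
  rw [add_mul, one_mul, map_add, coeff_derivative, mul_assoc, coeff_C_mul]
  cases n with
  | zero => simp
  | succ n => rw [coeff_succ_X_mul, coeff_derivative]; push_cast; ring

variable [CharZero K]

theorem rootSeries_mem (S : Subring K) (m : ℕ) : rootSeries K m ∈ hurwitzSubring S := by
  intro k
  have hk : (k.factorial : K) ≠ 0 := by exact_mod_cast k.factorial_ne_zero
  rw [rootSeries, coeff_mk, mul_div_cancel₀ _ hk]
  exact S.prod_mem fun i _ ↦ S.sub_mem S.one_mem (S.mul_mem (natCast_mem S i) (natCast_mem S m))

/-- The differential equation that characterises `(1 + m x)^(1/m)`. -/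
theorem rootSeries_ode (m : ℕ) :
    (1 + C (m : K) * X) * d⁄dX K (rootSeries K m) = rootSeries K m := by
  ext n
  have hk : (n.factorial : K) ≠ 0 := by exact_mod_cast n.factorial_ne_zero
  have hn : (n : K) + 1 ≠ 0 := by exact_mod_cast n.succ_ne_zero
  rw [coeff_one_add_mul_derivative, rootSeries, coeff_mk, coeff_mk, Finset.prod_range_succ,
    Nat.factorial_succ]
  push_cast
  generalize ∏ i ∈ Finset.range n, (1 - (i : K) * m) = p
  field_simp
  ring

theorem rootSeries_pow {m : ℕ} (hm : m ≠ 0) : rootSeries K m ^ m = 1 + C (m : K) * X := by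
  -- `y` and `1 + m x` solve the same equation `(1 + m x) y' = m y`, which determines every
  -- coefficient from the previous one.
  set y := rootSeries K m ^ m with hy
  have hode : (1 + C (m : K) * X) * d⁄dX K y = C (m : K) * y := by
    rw [hy, derivative_pow, ← map_natCast (C (R := K))]
    calc _ = C (m : K) * rootSeries K m ^ (m - 1) *
          ((1 + C (m : K) * X) * d⁄dX K (rootSeries K m)) := by ring
      _ = _ := by rw [rootSeries_ode, mul_assoc, pow_sub_one_mul hm]
  have hrec (n : ℕ) : coeff (n + 1) y * (n + 1) = m * (1 - n) * coeff n y := by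
    have := congrArg (coeff n) hode
    rw [coeff_one_add_mul_derivative, coeff_C_mul] at this
    linear_combination this
  have h0 : coeff 0 y = 1 := by simp [hy, constantCoeff_rootSeries]
  have h1 : coeff 1 y = m := by simpa [h0] using hrec 0
  have h2 (n : ℕ) : coeff (n + 2) y = 0 := by
    induction n with
    | zero => simpa [two_ne_zero, one_add_one_eq_two] using hrec 1
    | succ n ih =>
      have h := hrec (n + 2)
      rw [ih, mul_zero] at h
      refine (mul_eq_zero.mp h).resolve_right ?_
      exact_mod_cast (n + 2).succ_ne_zero
  ext (_ | _ | n)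
  · simp [h0]
  · simp [h1, coeff_one]
  · rw [h2, map_add, coeff_C_mul]
    simp [coeff_one, coeff_X]

end root

/-! ### Fixed points of contracting maps -/

section contraction

variable {K : Type*} [Field K]

theorem X_pow_dvd_subst_sub_subst (f : K⟦X⟧) {p q : K⟦X⟧} (hp : constantCoeff p = 0)
    (hq : constantCoeff q = 0) {n : ℕ} (h : X ^ n ∣ p - q) : X ^ n ∣ f.subst p - f.subst q := by
  rw [X_pow_dvd_iff]
  intro e he
  rw [map_sub, coeff_subst' (.of_constantCoeff_zero' hp), coeff_subst' (.of_constantCoeff_zero' hq),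
    sub_eq_zero]
  refine finsum_congr fun d ↦ ?_
  have := X_pow_dvd_iff.mp (h.trans (sub_dvd_pow_sub_pow p q d)) e he
  rw [map_sub, sub_eq_zero] at this
  rw [this]

theorem eq_zero_of_forall_X_pow_dvd {f : K⟦X⟧} (h : ∀ n, X ^ n ∣ f) : f = 0 := by
  ext n
  exact X_pow_dvd_iff.mp (h (n + 1)) n n.lt_succ_self

/-- Uniqueness of solutions of contracting equations: if agreement of `f` and `g` up to degree `n`
always improves by one degree, then `f = g`. -/
theorem eq_of_contracting {f g : K⟦X⟧} (h0 : constantCoeff f = constantCoeff g)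
    (h : ∀ n, 1 ≤ n → X ^ n ∣ f - g → X ^ (n + 1) ∣ f - g) : f = g := by
  rw [← sub_eq_zero]
  refine eq_zero_of_forall_X_pow_dvd fun n ↦ ?_
  have (n : ℕ) : X ^ (n + 1) ∣ f - g := by
    induction n with
    | zero => rw [pow_one, X_dvd_iff, map_sub, h0, sub_self]
    | succ n ih => exact h _ n.succ_pos ih
  exact (pow_dvd_pow _ n.le_succ).trans (this n)

theorem X_dvd_sub_of_constantCoeff_eq {f g : K⟦X⟧} (h : constantCoeff f = constantCoeff g) :
    X ^ 1 ∣ f - g := by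
  rw [pow_one, X_dvd_iff, map_sub, h, sub_self]

/-- A map on power series with constant coefficient `1` which preserves Hurwitz series and improves
`X`-adic closeness by one degree has a Hurwitz series as fixed point, namely the limit of the
iterates starting from `1`. -/
theorem exists_fixedPoint_mem_hurwitzSubring (S : Subring K) (F : K⟦X⟧ → K⟦X⟧)
    (hF : ∀ f ∈ hurwitzSubring S, constantCoeff f = 1 →
      F f ∈ hurwitzSubring S ∧ constantCoeff (F f) = 1)
    (hc : ∀ f g, constantCoeff f = 1 → constantCoeff g = 1 → ∀ n, 1 ≤ n → X ^ n ∣ f - g →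
      X ^ (n + 1) ∣ F f - F g) :
    ∃ f ∈ hurwitzSubring S, constantCoeff f = 1 ∧ F f = f := by
  have hmem (j : ℕ) : F^[j] 1 ∈ hurwitzSubring S ∧ constantCoeff (F^[j] 1) = 1 := by
    induction j with
    | zero => simp [one_mem]
    | succ j ih => rw [Function.iterate_succ_apply']; exact hF _ ih.1 ih.2
  have hstep (j : ℕ) : X ^ (j + 1) ∣ F^[j + 1] 1 - F^[j] 1 := by
    induction j with
    | zero =>
      exact X_dvd_sub_of_constantCoeff_eq (by rw [(hmem 1).2, (hmem 0).2])
    | succ j ih =>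
      rw [Function.iterate_succ_apply' F (j + 1), Function.iterate_succ_apply' F j]
      rw [Function.iterate_succ_apply' F j] at ih
      have h := (hmem (j + 1)).2
      rw [Function.iterate_succ_apply'] at h
      exact hc _ _ h (hmem j).2 _ j.succ_pos ih
  have hstab (j l : ℕ) : X ^ (j + 1) ∣ F^[j + l] 1 - F^[j] 1 := by
    induction l with
    | zero => simp
    | succ l ih =>
      rw [← sub_add_sub_cancel _ (F^[j + l] 1)]
      exact dvd_add ((pow_dvd_pow _ (by omega)).trans (hstep (j + l))) ih
  set f : K⟦X⟧ := mk fun n ↦ coeff n (F^[n] 1) with hf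
  have happrox (j : ℕ) : X ^ (j + 1) ∣ F^[j] 1 - f := by
    rw [X_pow_dvd_iff]
    intro i hi
    obtain ⟨l, rfl⟩ := Nat.exists_eq_add_of_le (Nat.lt_succ_iff.mp hi)
    have := X_pow_dvd_iff.mp (hstab i l) i i.lt_succ_self
    rw [map_sub] at this ⊢
    rwa [hf, coeff_mk]
  have hf0 : constantCoeff f = 1 := by
    rw [← coeff_zero_eq_constantCoeff_apply, hf, coeff_mk]; simp
  refine ⟨f, fun n ↦ ?_, hf0, ?_⟩
  · rw [hf, coeff_mk]
    exact (hmem n).1 n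
  · rw [← sub_eq_zero]
    refine eq_zero_of_forall_X_pow_dvd fun n ↦ ?_
    have h1 := hc _ _ hf0 (hmem n).2 _ n.succ_pos (by simpa using (happrox n).neg_right)
    rw [← Function.iterate_succ_apply' F] at h1
    rw [← sub_add_sub_cancel _ (F^[n + 1] 1)]
    exact dvd_add ((pow_dvd_pow _ (by omega)).trans h1)
      ((pow_dvd_pow _ (by omega)).trans (happrox (n + 1)))

end contraction

/-! ### Substitution and rescaling -/

section subst

variable {K : Type*} [Field K]

theorem constantCoeff_subst_of_constantCoeff_zero (f : K⟦X⟧) {g : K⟦X⟧}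
    (hg : constantCoeff g = 0) : constantCoeff (f.subst g) = constantCoeff f := by
  have hs : HasSubst g := .of_constantCoeff_zero' hg
  rw [← coeff_zero_eq_constantCoeff_apply, coeff_subst' hs, finsum_eq_single _ 0]
  · simp
  · intro d hd
    simp [hg, hd]

theorem rescale_subst (c : K) (f : K⟦X⟧) {g : K⟦X⟧} (hg : constantCoeff g = 0) :
    rescale c (f.subst g) = f.subst (rescale c g) := by
  rw [rescale_eq_subst, rescale_eq_subst, subst_comp_subst_apply (.of_constantCoeff_zero' hg)
    (HasSubst.smul_X' c)]

theorem subst_rescale (c : K) (f : K⟦X⟧) {g : K⟦X⟧} (hg : constantCoeff g = 0) :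
    (rescale c f).subst g = f.subst (C c * g) := by
  have hs : HasSubst g := .of_constantCoeff_zero' hg
  rw [rescale_eq_subst, subst_comp_subst_apply (HasSubst.smul_X' c) hs, subst_smul hs,
    subst_X hs, smul_eq_C_mul]

theorem constantCoeff_rescale (c : K) (f : K⟦X⟧) :
    constantCoeff (rescale c f) = constantCoeff f := by
  rw [← coeff_zero_eq_constantCoeff_apply, ← coeff_zero_eq_constantCoeff_apply, coeff_rescale,
    pow_zero, one_mul]

end subst

/-! ### The equations for the Böttcher coordinate and its inverse -/

section equations

variable {K : Type*} [Field K] [CharZero K]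

/-- In `f^m - g^m = (∑ f^i g^(m-1-i)) (f - g)` the first factor has constant coefficient `m`, so it
is a unit. -/
theorem X_pow_dvd_sub_of_pow {m : ℕ} (hm : m ≠ 0) {f g : K⟦X⟧} (hf : constantCoeff f = 1)
    (hg : constantCoeff g = 1) {n : ℕ} (h : X ^ n ∣ f ^ m - g ^ m) : X ^ n ∣ f - g := by
  rw [← (Commute.all f g).geom_sum₂_mul] at h
  have hu : IsUnit (∑ i ∈ Finset.range m, f ^ i * g ^ (m - 1 - i)) := by
    rw [isUnit_iff_constantCoeff, map_sum]
    simp [hf, hg, hm]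
  exact (hu.dvd_mul_left).mp h

/-- If `g` is `m` times a Hurwitz series without constant term, then so is `f ∘ g - 1`: writing
`g = m z`, it is the composite with `z` of `f(m x) - 1`, all of whose coefficients gain a factor
`m`. -/
theorem inv_mul_subst_sub_one_mem {S : Subring K} {m : ℕ} (hm : m ≠ 0) {f g : K⟦X⟧}
    (hf : f ∈ hurwitzSubring S) (hf0 : constantCoeff f = 1) (hg0 : constantCoeff g = 0)
    (hg : C (m : K)⁻¹ * g ∈ hurwitzSubring S) :
    C (m : K)⁻¹ * (f.subst g - 1) ∈ hurwitzSubring S := by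
  have hm' : (m : K) ≠ 0 := by exact_mod_cast hm
  set z := C (m : K)⁻¹ * g with hz
  have hz0 : constantCoeff z = 0 := by simp [hz, hg0]
  have hgz : g = C (m : K) * z := by rw [hz, ← mul_assoc, ← map_mul, mul_inv_cancel₀ hm']; simp
  have hs : HasSubst z := .of_constantCoeff_zero' hz0
  rw [hgz, ← subst_rescale _ _ hz0]
  have key : C (m : K)⁻¹ * ((rescale (m : K) f).subst z - 1) =
      (C (m : K)⁻¹ * (rescale (m : K) f - 1)).subst z := by
    rw [← coe_substAlgHom hs, ← smul_eq_C_mul, ← smul_eq_C_mul, map_smul, map_sub, map_one]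
  rw [key]
  refine hurwitzSubring.subst_mem ?_ hg hz0
  rintro (_ | n)
  · simp [constantCoeff_rescale, hf0]
  · have h := S.mul_mem (S.pow_mem (natCast_mem S m) n) (hf (n + 1))
    convert h using 1
    rw [coeff_C_mul, map_sub, coeff_rescale, coeff_one, if_neg n.succ_ne_zero]
    field_simp
    ring

/-- The equation `v^m = B · (v ∘ Φ)` has a solution among Hurwitz series over `S` as soon as `B - 1`
and `Φ` are `m` times Hurwitz series and `Φ` has order at least `2`. For `S = ⊤` this is bare
existence over `K`. -/
theorem exists_pow_eq_mul_subst (S : Subring K) {m : ℕ} (hm : m ≠ 0) {B Φ : K⟦X⟧}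
    (hB0 : constantCoeff B = 1) (hB : C (m : K)⁻¹ * (B - 1) ∈ hurwitzSubring S)
    (hΦ2 : X ^ 2 ∣ Φ) (hΦ : C (m : K)⁻¹ * Φ ∈ hurwitzSubring S) :
    ∃ v ∈ hurwitzSubring S, constantCoeff v = 1 ∧ v ^ m = B * v.subst Φ := by
  have hm' : (m : K) ≠ 0 := by exact_mod_cast hm
  have hΦ0 : constantCoeff Φ = 0 := X_dvd_iff.mp ((dvd_pow_self X two_ne_zero).trans hΦ2)
  have hs : HasSubst Φ := .of_constantCoeff_zero' hΦ0
  -- `v` is a solution as soon as it is fixed by `v ↦ (1 + m z(v))^(1/m)`.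
  let z : K⟦X⟧ → K⟦X⟧ := fun v ↦ C (m : K)⁻¹ * (B * v.subst Φ - 1)
  have hz0 (v : K⟦X⟧) (hv : constantCoeff v = 1) : constantCoeff (z v) = 0 := by
    simp [z, hB0, constantCoeff_subst_of_constantCoeff_zero v hΦ0, hv]
  suffices h : ∃ v ∈ hurwitzSubring S, constantCoeff v = 1 ∧ (rootSeries K m).subst (z v) = v by
    obtain ⟨v, hv, hv0, hfix⟩ := h
    refine ⟨v, hv, hv0, ?_⟩
    have hsz : HasSubst (z v) := .of_constantCoeff_zero' (hz0 v hv0)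
    conv_lhs => rw [← hfix]
    rw [← subst_pow hsz, rootSeries_pow hm, ← coe_substAlgHom hsz, ← smul_eq_C_mul, map_add,
      map_one, map_smul, substAlgHom_X, smul_eq_C_mul, ← mul_assoc, ← map_mul, mul_inv_cancel₀ hm']
    simp
  refine exists_fixedPoint_mem_hurwitzSubring S (fun v ↦ (rootSeries K m).subst (z v))
    (fun v hv hv0 ↦ ?_) (fun v w hv hw n hn h ↦ ?_)
  · refine ⟨hurwitzSubring.subst_mem (rootSeries_mem S m) ?_ (hz0 v hv0), ?_⟩
    · have h := inv_mul_subst_sub_one_mem hm hv hv0 hΦ0 hΦ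
      have hB' : B ∈ hurwitzSubring S := by
        have h := add_mem (hurwitzSubring.natCast_mul_mem m hB) (one_mem _)
        rw [← mul_assoc, ← map_mul, mul_inv_cancel₀ hm'] at h
        simpa using h
      convert add_mem hB (mul_mem hB' h) using 1
      simp only [z]
      ring
    · rw [constantCoeff_subst_of_constantCoeff_zero _ (hz0 v hv0), constantCoeff_rootSeries]
  · refine X_pow_dvd_subst_sub_subst _ (hz0 v hv) (hz0 w hw) ?_
    obtain ⟨r, hr⟩ := h
    have hd : X ^ (n + 1) ∣ v.subst Φ - w.subst Φ := by
      rw [← subst_sub hs, hr, subst_mul hs, subst_pow hs, subst_X hs]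
      refine Dvd.dvd.mul_right ?_ _
      refine (pow_dvd_pow X (by omega : n + 1 ≤ 2 * n)).trans ?_
      rw [pow_mul]
      exact pow_dvd_pow_of_dvd hΦ2 n
    convert hd.mul_left (C (m : K)⁻¹ * B) using 1
    simp only [z]
    ring

theorem eq_of_pow_eq_mul_subst {m : ℕ} (hm : m ≠ 0) {B Φ v w : K⟦X⟧} (hΦ2 : X ^ 2 ∣ Φ)
    (hv0 : constantCoeff v = 1) (hw0 : constantCoeff w = 1) (hv : v ^ m = B * v.subst Φ)
    (hw : w ^ m = B * w.subst Φ) : v = w := by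
  have hΦ0 : constantCoeff Φ = 0 := X_dvd_iff.mp ((dvd_pow_self X two_ne_zero).trans hΦ2)
  have hs : HasSubst Φ := .of_constantCoeff_zero' hΦ0
  refine eq_of_contracting (hv0.trans hw0.symm) fun n hn h ↦ X_pow_dvd_sub_of_pow hm hv0 hw0 ?_
  rw [hv, hw, ← mul_sub, ← subst_sub hs]
  obtain ⟨r, hr⟩ := h
  rw [hr, subst_mul hs, subst_pow hs, subst_X hs]
  refine Dvd.dvd.mul_left (Dvd.dvd.mul_right ?_ _) _
  refine (pow_dvd_pow X (by omega : n + 1 ≤ 2 * n)).trans ?_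
  rw [pow_mul]
  exact pow_dvd_pow_of_dvd hΦ2 n

/-- Solutions of the contracting equation `u = w(x u)` are Hurwitz series if `w` is one. -/
theorem mem_of_eq_subst_X_mul {S : Subring K} {u w : K⟦X⟧} (hw : w ∈ hurwitzSubring S)
    (hw0 : constantCoeff w = 1) (hu0 : constantCoeff u = 1) (h : u = w.subst (X * u)) :
    u ∈ hurwitzSubring S := by
  have hX (f : K⟦X⟧) : constantCoeff (X * f) = 0 := by simp
  have hXmem : (X : K⟦X⟧) ∈ hurwitzSubring S := fun n ↦ by
    rw [coeff_X]; split_ifs <;> simp [natCast_mem]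
  have hc (f g : K⟦X⟧) (n : ℕ) (h : X ^ n ∣ f - g) :
      X ^ (n + 1) ∣ w.subst (X * f) - w.subst (X * g) := by
    refine X_pow_dvd_subst_sub_subst _ (hX f) (hX g) ?_
    rw [← mul_sub, pow_succ']
    exact mul_dvd_mul_left X h
  obtain ⟨f, hf, hf0, hfix⟩ := exists_fixedPoint_mem_hurwitzSubring S
    (fun f ↦ w.subst (X * f))
    (fun f hf _ ↦ ⟨hurwitzSubring.subst_mem hw (mul_mem hXmem hf) (hX f),
      by rw [constantCoeff_subst_of_constantCoeff_zero _ (hX f), hw0]⟩)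
    (fun f g _ _ n _ h ↦ hc f g n h)
  have : u = f := by
    refine eq_of_contracting (hu0.trans hf0.symm) fun n _ hn ↦ ?_
    have := hc u f n hn
    rwa [← h, hfix] at this
  rwa [this]

/-- If `x v` and `x u` are inverse under composition and `v(c x)` is a Hurwitz series, then so is
`u(c x)`: since `u = v⁻¹(x u)`, the series `u(c x)` solves `U = W(x U)` with `W` the Hurwitz series
`v(c x)⁻¹`. -/
theorem rescale_mem_of_subst_eq_X {S : Subring K} (c : K) {u v : K⟦X⟧}
    (hv0 : constantCoeff v = 1) (hu0 : constantCoeff u = 1)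
    (hv : rescale c v ∈ hurwitzSubring S) (h : (X * v).subst (X * u) = X) :
    rescale c u ∈ hurwitzSubring S := by
  have hX (f : K⟦X⟧) : constantCoeff (X * f) = 0 := by simp
  have hs : HasSubst (X * u) := .of_constantCoeff_zero' (hX u)
  rw [subst_mul hs, subst_X hs, mul_assoc] at h
  have h1 : u * v.subst (X * u) = 1 := mul_left_cancel₀ X_ne_zero (h.trans (mul_one X).symm)
  have hvv : v⁻¹ * v = 1 := PowerSeries.inv_mul_cancel _ (by simp [hv0])
  have h2 : u = v⁻¹.subst (X * u) := by
    have h3 : v⁻¹.subst (X * u) * v.subst (X * u) = 1 := by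
      rw [← subst_mul hs, hvv, ← coe_substAlgHom hs, map_one]
    exact mul_right_cancel₀ (right_ne_zero_of_mul_eq_one h1) (h1.trans h3.symm)
  have hinv : rescale c v⁻¹ = (rescale c v)⁻¹ := by
    rw [PowerSeries.eq_inv_iff_mul_eq_one (by simp [constantCoeff_rescale, hv0]), ← map_mul, hvv, map_one]
  refine mem_of_eq_subst_X_mul (w := rescale c v⁻¹) ?_ ?_ ?_ ?_
  · rw [hinv]; exact hurwitzSubring.inv_mem hv (by rw [constantCoeff_rescale, hv0])
  · rw [constantCoeff_rescale]; simp [hv0]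
  · rw [constantCoeff_rescale, hu0]
  · conv_lhs => rw [h2]
    rw [rescale_subst _ _ (hX u), map_mul, rescale_X, subst_rescale _ _ (hX _), mul_assoc]

end equations

/-! ### Böttcher coordinates -/

section Bottcher

variable {K : Type*} [Field K] {m : ℕ} {φ f g : K⟦X⟧}

theorem exists_eq_X_mul (hf0 : constantCoeff f = 0) (hf1 : coeff 1 f = 1) :
    ∃ u : K⟦X⟧, f = X * u ∧ constantCoeff u = 1 := by
  obtain ⟨u, rfl⟩ := X_dvd_iff.mpr hf0
  refine ⟨u, rfl, ?_⟩
  rwa [← zero_add 1, coeff_succ_X_mul, coeff_zero_eq_constantCoeff_apply] at hf1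

theorem subst_subst_cancel (hf0 : constantCoeff f = 0) (hg0 : constantCoeff g = 0)
    (hgf : g.subst f = X) (h : K⟦X⟧) : PowerSeries.subst f (h.subst g : K⟦X⟧) = h := by
  rw [subst_comp_subst_apply (.of_constantCoeff_zero' hg0) (.of_constantCoeff_zero' hf0), hgf,
    X_subst]

/-- For mutually inverse `f` and `g`, the equations `φ(f(x)) = f(x^m)` and `g(φ(x)) = g(x)^m` are
equivalent. -/
theorem subst_eq_subst_X_pow_iff (hm : m ≠ 0) (hφ0 : constantCoeff φ = 0)
    (hf0 : constantCoeff f = 0) (hg0 : constantCoeff g = 0)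
    (hgf : g.subst f = X) (hfg : f.subst g = X) :
    φ.subst f = f.subst (X ^ m : K⟦X⟧) ↔ g.subst φ = g ^ m := by
  have hf : HasSubst f := .of_constantCoeff_zero' hf0
  have hg : HasSubst g := .of_constantCoeff_zero' hg0
  have hφ : HasSubst φ := .of_constantCoeff_zero' hφ0
  have hX : HasSubst (X ^ m : K⟦X⟧) := .X_pow hm
  constructor
  · intro h
    have h1 : φ = f.subst (g ^ m) := by
      rw [← subst_subst_cancel hg0 hf0 hfg φ, h, subst_comp_subst_apply hX hg, subst_pow hg, subst_X hg]
    have hgm : constantCoeff (g ^ m) = 0 := by simp [hg0, hm]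
    rw [h1, ← subst_comp_subst_apply hf (.of_constantCoeff_zero' hgm), hgf,
      subst_X (.of_constantCoeff_zero' hgm)]
  · intro h
    have hφf : constantCoeff (φ.subst f) = 0 := by
      rw [constantCoeff_subst_of_constantCoeff_zero _ hf0, hφ0]
    have h1 : g.subst (φ.subst f) = X ^ m := by
      rw [← subst_comp_subst_apply hφ hf, h, subst_pow hf, hgf]
    rw [← h1, ← subst_comp_subst_apply hg (.of_constantCoeff_zero' hφf), hfg,
      subst_X (.of_constantCoeff_zero' hφf)]

theorem X_mul_subst_eq_pow_iff (hm : m ≠ 0) {B v : K⟦X⟧} :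
    (X * v).subst (X ^ m * B) = (X * v) ^ m ↔ v ^ m = B * v.subst (X ^ m * B) := by
  have hs : HasSubst (X ^ m * B) := .of_constantCoeff_zero' (by simp [hm])
  rw [subst_mul hs, subst_X hs, mul_pow, mul_assoc, eq_comm]
  exact mul_right_inj' (pow_ne_zero m X_ne_zero)

namespace IsBottcherCoordinate

theorem constantCoeff_inverse (hf : IsBottcherCoordinate m φ f) :
    constantCoeff hf.inverse = 0 :=
  constantCoeff_substInvOfIsUnit _ hf.isUnit_coeff_one

theorem coeff_one_inverse (hf : IsBottcherCoordinate m φ f) : coeff 1 hf.inverse = 1 := by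
  rw [inverse, coeff_one_substInvOfIsUnit,
    show hf.isUnit_coeff_one.unit = 1 from Units.ext hf.coeff_one_eq_one, inv_one, Units.val_one]

theorem subst_inverse_right (hf : IsBottcherCoordinate m φ f) : f.subst hf.inverse = X :=
  subst_substInvOfIsUnit_right _ hf.constantCoeff_eq_zero _

theorem subst_inverse_left (hf : IsBottcherCoordinate m φ f) : hf.inverse.subst f = X :=
  subst_substInvOfIsUnit_left _ hf.constantCoeff_eq_zero _

/-- The inverse of a Böttcher coordinate is `x v` with `v^m = B · (v ∘ φ)`. -/
theorem exists_inverse_eq (hm : m ≠ 0) {B : K⟦X⟧} (hf : IsBottcherCoordinate m (X ^ m * B) f) :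
    ∃ v, hf.inverse = X * v ∧ constantCoeff v = 1 ∧ v ^ m = B * v.subst (X ^ m * B) := by
  obtain ⟨v, hv, hv0⟩ := exists_eq_X_mul hf.constantCoeff_inverse hf.coeff_one_inverse
  refine ⟨v, hv, hv0, ?_⟩
  rw [← X_mul_subst_eq_pow_iff hm, ← hv]
  exact (subst_eq_subst_X_pow_iff hm (by simp [hm]) hf.constantCoeff_eq_zero
    hf.constantCoeff_inverse hf.subst_inverse_left hf.subst_inverse_right).mp
    hf.functional_equation

end IsBottcherCoordinate

theorem existsUnique_isBottcherCoordinate [CharZero K] (hm : 2 ≤ m) {B : K⟦X⟧}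
    (hB : constantCoeff B = 1) : ∃! f : K⟦X⟧, IsBottcherCoordinate m (X ^ m * B) f := by
  have hm0 : m ≠ 0 := by omega
  have hX2 : X ^ 2 ∣ X ^ m * B := (pow_dvd_pow X hm).mul_right B
  obtain ⟨v, -, hv0, hv⟩ := exists_pow_eq_mul_subst (⊤ : Subring K) hm0 hB
    (fun _ ↦ Subring.mem_top _) hX2 (fun _ ↦ Subring.mem_top _)
  have hg0 : constantCoeff (X * v) = 0 := by simp
  have hg1 : coeff 1 (X * v) = 1 := by
    rw [← zero_add 1, coeff_succ_X_mul, coeff_zero_eq_constantCoeff_apply, hv0]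
  have hu : IsUnit (coeff 1 (X * v)) := hg1 ▸ isUnit_one
  refine existsUnique_of_exists_of_unique ⟨substInvOfIsUnit (X * v) hu, ?_, ?_, ?_⟩ ?_
  · exact constantCoeff_substInvOfIsUnit _ hu
  · rw [coeff_one_substInvOfIsUnit, show hu.unit = 1 from Units.ext hg1, inv_one, Units.val_one]
  · exact (subst_eq_subst_X_pow_iff hm0 (by simp [hm0]) (constantCoeff_substInvOfIsUnit _ hu) hg0
      (subst_substInvOfIsUnit_right _ hg0 hu) (subst_substInvOfIsUnit_left _ hg0 hu)).mpr
      ((X_mul_subst_eq_pow_iff hm0).mpr hv)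
  · intro f₁ f₂ h₁ h₂
    obtain ⟨v₁, e₁, c₁, p₁⟩ := h₁.exists_inverse_eq hm0
    obtain ⟨v₂, e₂, c₂, p₂⟩ := h₂.exists_inverse_eq hm0
    have hg : h₁.inverse = h₂.inverse := by
      rw [e₁, e₂, eq_of_pow_eq_mul_subst hm0 hX2 c₁ c₂ p₁ p₂]
    have h := subst_subst_cancel h₁.constantCoeff_eq_zero h₂.constantCoeff_inverse
      (hg ▸ h₁.subst_inverse_left) f₂
    rw [h₂.subst_inverse_right, subst_X (.of_constantCoeff_zero' h₁.constantCoeff_eq_zero)] at h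
    exact h

end Bottcher

/-! ### Integrality of the coefficients -/

section factorialForm

variable {R K : Type*} [CommRing R] [CharZero R] [Field K] [Algebra R K] [IsFractionRing R K]

theorem hasFactorialForm_of_rescale_mem {d : ℕ} (hd : d ≠ 0) {v : K⟦X⟧}
    (hv0 : constantCoeff v = 1)
    (hv : rescale (d : K) v ∈ hurwitzSubring (algebraMap R K).range) :
    HasFactorialForm R d (X * v) := by
  have : CharZero K := charZero_of_injective_algebraMap (IsFractionRing.injective R K)
  choose a ha using hv
  refine ⟨a, ?_, ?_⟩
  · apply IsFractionRing.injective R K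
    rw [ha, map_one, coeff_zero_eq_constantCoeff_apply, constantCoeff_rescale, hv0]
    simp
  · congr 1
    ext k
    have hk : (k.factorial : K) ≠ 0 := by exact_mod_cast k.factorial_ne_zero
    have hd' : (d : K) ≠ 0 := by exact_mod_cast hd
    rw [coeff_mk, ha, coeff_rescale]
    field_simp

/-- With `Φ(x) = φ(d x) / d`, the series `v(d x)` solves `V^m = B(d x) · (V ∘ Φ)`, so it is a Hurwitz
series over `R` whenever `B(d x) - 1` and `Φ` are `m` times Hurwitz series. -/
theorem IsBottcherCoordinate.hasFactorialForm [IsDomain R] {m d : ℕ} (hm : 2 ≤ m) (hd : d ≠ 0) {B f : K⟦X⟧}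
    (hf : IsBottcherCoordinate m (X ^ m * B) f) (hB0 : constantCoeff B = 1)
    (hB : C (m : K)⁻¹ * (rescale (d : K) B - 1) ∈ hurwitzSubring (algebraMap R K).range)
    (hφ : C (m : K)⁻¹ * (C (d : K)⁻¹ * rescale (d : K) (X ^ m * B)) ∈
      hurwitzSubring (algebraMap R K).range) :
    HasFactorialForm R d f ∧ HasFactorialForm R d hf.inverse := by
  have : CharZero K := charZero_of_injective_algebraMap (IsFractionRing.injective R K)
  have hm0 : m ≠ 0 := by omega
  have hd' : (d : K) ≠ 0 := by exact_mod_cast hd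
  have hX0 : constantCoeff (X ^ m * B) = 0 := by simp [hm0]
  obtain ⟨v, hv, hv0, hvm⟩ := hf.exists_inverse_eq hm0
  obtain ⟨u, hu, hu0⟩ := exists_eq_X_mul hf.constantCoeff_eq_zero hf.coeff_one_eq_one
  set Φ := C (d : K)⁻¹ * rescale (d : K) (X ^ m * B) with hΦ
  have hΦ2 : X ^ 2 ∣ Φ := by
    refine ((pow_dvd_pow X hm).trans ?_).mul_left _
    rw [map_mul, map_pow, rescale_X, mul_pow]
    exact (dvd_mul_left _ _).mul_right _
  have hΦ0 : constantCoeff Φ = 0 := X_dvd_iff.mp ((dvd_pow_self X two_ne_zero).trans hΦ2)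
  have hrB0 : constantCoeff (rescale (d : K) B) = 1 := by rw [constantCoeff_rescale, hB0]
  have hrv0 : constantCoeff (rescale (d : K) v) = 1 := by rw [constantCoeff_rescale, hv0]
  have hrv : rescale (d : K) v ^ m = rescale (d : K) B * (rescale (d : K) v).subst Φ := by
    rw [← map_pow, hvm, map_mul, rescale_subst _ _ hX0, subst_rescale _ _ hΦ0, hΦ, ← mul_assoc,
      ← map_mul, mul_inv_cancel₀ hd', map_one, one_mul]
  obtain ⟨w, hw, hw0, hwm⟩ := exists_pow_eq_mul_subst (algebraMap R K).range hm0 hrB0 hB hΦ2 hφ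
  have hmem : rescale (d : K) v ∈ hurwitzSubring (algebraMap R K).range := by
    rwa [eq_of_pow_eq_mul_subst hm0 hΦ2 hrv0 hw0 hrv hwm]
  have hinv := hf.subst_inverse_left
  rw [hv]
  refine ⟨?_, hasFactorialForm_of_rescale_mem hd hv0 hmem⟩
  rw [hv, hu] at hinv
  rw [hu]
  exact hasFactorialForm_of_rescale_mem hd hu0
    (rescale_mem_of_subst_eq_X (d : K) hv0 hu0 hmem hinv)

end factorialForm

section divisibility

variable {R : Type*} [CommRing R]

theorem inv_mul_mem_hurwitzSubring_of_dvd (K : Type*) [Field K] [CharZero K] [Algebra R K]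
    {m : ℕ} (hm : m ≠ 0) {f : K⟦X⟧}
    (h : ∀ k, ∃ c : R, (k.factorial : K) * coeff k f = algebraMap R K (m * c)) :
    C (m : K)⁻¹ * f ∈ hurwitzSubring (algebraMap R K).range := by
  intro k
  have hm' : (m : K) ≠ 0 := by exact_mod_cast hm
  obtain ⟨c, hc⟩ := h k
  refine ⟨c, ?_⟩
  rw [coeff_C_mul, mul_left_comm, hc, map_mul, map_natCast, inv_mul_cancel_left₀ hm']

theorem exists_factorial_mul_eq {m k : ℕ} (hm : m ≠ 0) (h : m ≤ k) (r : R) :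
    ∃ c : R, (k.factorial : R) * r = m * c := by
  obtain ⟨l, hl⟩ := Nat.dvd_factorial (Nat.pos_of_ne_zero hm) h
  exact ⟨l * r, by rw [hl]; push_cast; ring⟩

end divisibility

theorem theorem3 {R K : Type*} [CommRing R] [IsDomain R] [CharZero R]
    [Field K] [Algebra R K] [IsFractionRing R K]
    (m : ℕ) (hm : 2 ≤ m) (b : ℕ → R) (hb : b 0 = 1)
    (φ : R⟦X⟧) (hφ : φ = X ^ m * PowerSeries.mk b) :
    (∃! f : K⟦X⟧, IsBottcherCoordinate m (φ.map (algebraMap R K)) f) ∧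
    (∀ (f : K⟦X⟧) (hf : IsBottcherCoordinate m (φ.map (algebraMap R K)) f),
      (HasFactorialForm R m f ∧ HasFactorialForm R m hf.inverse) ∧
      ((∀ k, 1 ≤ k → k < m → (k.factorial : R) * b k ∈ Ideal.span {(m : R)}) →
        HasFactorialForm R 1 f ∧ HasFactorialForm R 1 hf.inverse)) ∧
    ((∃ ψ : R⟦X⟧, φ = X ^ m + (m : R⟦X⟧) * X ^ (m + 1) * ψ) →
      ∀ k, 1 ≤ k → k < m → (k.factorial : R) * b k ∈ Ideal.span {(m : R)}) := by
  have : CharZero K := charZero_of_injective_algebraMap (IsFractionRing.injective R K)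
  have hm0 : m ≠ 0 := by omega
  set B : K⟦X⟧ := (mk b).map (algebraMap R K) with hB
  have hBk (k : ℕ) : coeff k B = algebraMap R K (b k) := by rw [hB, coeff_map, coeff_mk]
  have hB0 : constantCoeff B = 1 := by
    rw [← coeff_zero_eq_constantCoeff_apply, hBk, hb, map_one]
  have hφB : φ.map (algebraMap R K) = X ^ m * B := by rw [hφ, map_mul, map_pow, map_X]
  refine ⟨hφB ▸ existsUnique_isBottcherCoordinate hm hB0, ?_, ?_⟩
  · rw [hφB]
    refine fun f hf ↦ ⟨hf.hasFactorialForm hm hm0 hB0 ?_ ?_, fun h ↦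
      hf.hasFactorialForm hm one_ne_zero hB0 ?_ ?_⟩
    · refine inv_mul_mem_hurwitzSubring_of_dvd K hm0 ?_
      rintro (_ | k)
      · exact ⟨0, by simp [constantCoeff_rescale, hB0]⟩
      · refine ⟨(k + 1).factorial * (m ^ k * b (k + 1)), ?_⟩
        rw [map_sub, coeff_one, if_neg k.succ_ne_zero, sub_zero, coeff_rescale, hBk]
        push_cast
        ring
    · refine inv_mul_mem_hurwitzSubring_of_dvd K hm0 fun k ↦ ?_
      have hm' : (m : K) ≠ 0 := by exact_mod_cast hm0
      rw [coeff_C_mul, coeff_rescale, coeff_X_pow_mul']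
      split_ifs with hk
      · -- The coefficient of `φ(m x) / m` carries `m^(k-1)` with `k ≥ m ≥ 2`.
        obtain ⟨l, rfl⟩ := Nat.exists_eq_add_of_le (hm.trans hk)
        refine ⟨(2 + l).factorial * (m ^ l * b (2 + l - m)), ?_⟩
        rw [hBk, pow_add]
        push_cast
        field_simp
      · exact ⟨0, by simp⟩
    · rw [Nat.cast_one, rescale_one, RingHom.id_apply]
      refine inv_mul_mem_hurwitzSubring_of_dvd K hm0 fun k ↦ ?_
      rcases Nat.eq_zero_or_pos k with rfl | hk
      · exact ⟨0, by simp [hB0]⟩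
      · have hc : ∃ c : R, (k.factorial : R) * b k = m * c := by
          rcases lt_or_ge k m with hkm | hkm
          · exact Ideal.mem_span_singleton.mp (h k hk hkm)
          · exact exists_factorial_mul_eq hm0 hkm _
        obtain ⟨c, hc⟩ := hc
        refine ⟨c, ?_⟩
        rw [← hc, map_sub, coeff_one, if_neg hk.ne', sub_zero, hBk, map_mul, map_natCast]
    · rw [Nat.cast_one, inv_one, map_one, one_mul, rescale_one, RingHom.id_apply]
      refine inv_mul_mem_hurwitzSubring_of_dvd K hm0 fun k ↦ ?_
      rw [coeff_X_pow_mul']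
      split_ifs with hk
      · obtain ⟨c, hc⟩ := exists_factorial_mul_eq hm0 hk (b (k - m))
        exact ⟨c, by rw [← hc, hBk, map_mul, map_natCast]⟩
      · exact ⟨0, by simp⟩
  · rintro ⟨ψ, hψ⟩ k hk -
    have h : (mk b : R⟦X⟧) = 1 + C (m : R) * (X * ψ) := by
      refine mul_left_cancel₀ (pow_ne_zero m X_ne_zero) ?_
      rw [← hφ, hψ, map_natCast]
      ring
    have hbk : b k = m * coeff k (X * ψ) := by
      have := congrArg (coeff k) h
      rwa [coeff_mk, map_add, coeff_one, if_neg (by omega), zero_add, coeff_C_mul] at this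
    rw [hbk]
    exact Ideal.mul_mem_left _ _ (Ideal.mul_mem_right _ _ (Ideal.mem_span_singleton_self _))
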